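/- Let $M$ be a smooth finite-dimensional manifold without boundary, $\pi\colon TM\to M$ its tangent bundle, and let $T_2$ be a smooth pseudo-Riemannian metric on $M$, i.e. a smooth field of nondegenerate symmetric bilinear forms on the tangent spaces. All vector fields and differential forms below are smooth. A vector tangent to $TM$ is vertical if $\pi_*$ annihilates it, and a 1-form on $TM$ is horizontal if it vanishes on all vertical vectors. A second-order differential equation on $M$ is a vector field $D$ on $TM$ with $\pi_*(D_v)=v$ for every $v\in TM$. Let $\theta$ be the Liouville form of $T^*M$, whose value at a covector $\beta\in T^*M$ is the pullback of $\beta$ by the projection $T^*M\to M$, and let $\omega_2$ denote the 2-form on $TM$ obtained by pulling back $d\theta$ by the map $TM\to T^*M$, $v\mapsto i_vT_2$. Let $T\colon TM\to\mathbb R$, $T(v)=\tfrac12T_2(v,v)$, be the kinetic energy. (1) The equation $$i_D\omega_2+dT+\alpha=0$$ establishes a bijection between the second-order differential equations $D$ on $M$ and the horizontal 1-forms $\alpha$ on $TM$. (2) Let $D$ and $\alpha$ correspond to each other in this way, and let $u$ be a vector field on $M$. Then $u$ is an intermediate integral of $D$, meaning that $D$ is tangent to the image of the section $u\colon M\to TM$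 (for every $x\in M$, $D_{u(x)}$ belongs to the image of the differential of $u\colon M\to TM$ at $x$), if and only if $$i_u\,d(i_uT_2)+d(T(u))+u^*\alpha=0$$ on $M$, where $T(u)=T\circ u$ and $u^*\alpha$ is the pullback of $\alpha$ by the section $u\colon M\to TM$. -/

import Mathlib

open Bundle Set
open scoped Manifold ContDiff

noncomputable section

namespace Mechanics

/-! ### Differential forms of degree one and two on a manifold -/

section Forms

variable {F H N : Type*} [NormedAddCommGroup F] [NormedSpace ℝ F]
  [TopologicalSpace H] (J : ModelWithCorners ℝ F H) [TopologicalSpace N] [ChartedSpace H N]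

/-- The expression of the 1-form `α` in the preferred chart around `x₀`: the pullback of `α` by
the inverse of the chart, as a differential 1-form on the model vector space. -/
def chartForm (α : (x : N) → TangentSpace J x →L[ℝ] ℝ) (x₀ : N) (y : F) : F [⋀^Fin 1]→L[ℝ] ℝ :=
  ContinuousAlternatingMap.ofSubsingleton ℝ F ℝ (0 : Fin 1)
    ((α ((extChartAt J x₀).symm y)).comp
      (mfderivWithin 𝓘(ℝ, F) J (extChartAt J x₀).symm (range J) y))

/-- The exterior derivative `(dα)_{x₀}(v, w)` of a 1-form `α` on a manifold, computed in the
preferred chart around `x₀`. The normalization is `dα(X, Y) = X(α(Y)) - Y(α(X)) - α([X, Y])`. -/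
def extDerivOneForm (α : (x : N) → TangentSpace J x →L[ℝ] ℝ) (x₀ : N)
    (v w : TangentSpace J x₀) : ℝ :=
  extDerivWithin (chartForm J α x₀) (range J) (extChartAt J x₀ x₀)
    ![(mfderiv J 𝓘(ℝ, F) (extChartAt J x₀) x₀ v : F),
      (mfderiv J 𝓘(ℝ, F) (extChartAt J x₀) x₀ w : F)]

variable [IsManifold J 1 N]

/-- Smoothness of a vector field. -/
def IsSmoothVectorField (X : (x : N) → TangentSpace J x) : Prop :=
  ContMDiff J J.tangent ∞ (fun x ↦ (⟨x, X x⟩ : TangentBundle J N))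

/-- Smoothness of a 1-form. -/
def IsSmoothOneForm (α : (x : N) → TangentSpace J x →L[ℝ] ℝ) : Prop :=
  ContMDiff J (J.prod 𝓘(ℝ, F →L[ℝ] ℝ)) ∞ (fun x ↦ TotalSpace.mk' (F →L[ℝ] ℝ) x (α x))

end Forms

section Mechanics

variable (E M : Type*) [NormedAddCommGroup E] [NormedSpace ℝ E]
  [TopologicalSpace M] [ChartedSpace E M] [IsManifold 𝓘(ℝ, E) ∞ M]

/-- The tangent bundle `TM`. -/
abbrev TB : Type _ := TangentBundle 𝓘(ℝ, E) M

/-- The cotangent bundle `T*M`. -/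
abbrev CTB : Type _ :=
  TotalSpace (E →L[ℝ] ℝ) (fun x : M ↦ TangentSpace 𝓘(ℝ, E) x →L[ℝ] ℝ)

/-- The model with corners of `TM`. -/
abbrev ITB : ModelWithCorners ℝ (E × E) (ModelProd E E) := 𝓘(ℝ, E).tangent

/-- The model with corners of `T*M`. -/
abbrev ICTB : ModelWithCorners ℝ (E × (E →L[ℝ] ℝ)) (ModelProd E (E →L[ℝ] ℝ)) :=
  𝓘(ℝ, E).prod 𝓘(ℝ, E →L[ℝ] ℝ)

variable {E M}

/-- The differential at `p` of the projection `TM → M`. -/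
def dProj (p : TB E M) : TangentSpace (ITB E) p →L[ℝ] TangentSpace 𝓘(ℝ, E) p.proj :=
  mfderiv (ITB E) 𝓘(ℝ, E) (TotalSpace.proj : TB E M → M) p

/-- A tangent vector to `TM` is vertical when it projects to zero on `M`. -/
def IsVertical (p : TB E M) (V : TangentSpace (ITB E) p) : Prop :=
  dProj p V = 0

/-- A 1-form on `TM` is horizontal when it annihilates all vertical vectors. -/
def IsHorizontal (α : (p : TB E M) → TangentSpace (ITB E) p →L[ℝ] ℝ) : Prop :=
  ∀ (p : TB E M) (V : TangentSpace (ITB E) p), IsVertical p V → α p V = 0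

variable (E M) in
/-- The smooth horizontal 1-forms on `TM`. -/
structure HorizontalForm where
  /-- The value of the form at a point of `TM`. -/
  toFun : (p : TB E M) → TangentSpace (ITB E) p →L[ℝ] ℝ
  smooth : IsSmoothOneForm (ITB E) toFun
  horizontal : IsHorizontal toFun

variable (E M) in
/-- The second-order differential equations on `M`: the smooth vector fields `D` on `TM` such that
`π_*(D_v) = v` for all `v` in `TM`. -/
structure SecondOrderEquation where
  /-- The value of the vector field at a point of `TM`. -/
  toFun : (p : TB E M) → TangentSpace (ITB E) p
  smooth : IsSmoothVectorField (ITB E) toFun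
  proj_eq : ∀ p : TB E M, dProj p (toFun p) = p.2

variable (E M) in
/-- A smooth pseudo-Riemannian metric: a smooth field of nondegenerate symmetric bilinear forms. -/
structure PseudoRiemannianMetric where
  /-- The bilinear form on each tangent space. -/
  val : (x : M) → TangentSpace 𝓘(ℝ, E) x →L[ℝ] TangentSpace 𝓘(ℝ, E) x →L[ℝ] ℝ
  symm : ∀ (x : M) (v w : TangentSpace 𝓘(ℝ, E) x), val x v w = val x w v
  nondegenerate : ∀ (x : M) (v : TangentSpace 𝓘(ℝ, E) x), (∀ w, val x v w = 0) → v = 0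
  smooth : ContMDiff 𝓘(ℝ, E) (𝓘(ℝ, E).prod 𝓘(ℝ, E →L[ℝ] E →L[ℝ] ℝ)) ∞
    (fun x ↦ TotalSpace.mk' (E →L[ℝ] E →L[ℝ] ℝ) x (val x))

/-- The Liouville form of `T*M`: its value at a covector is the pullback of that covector by the
projection `T*M → M`. -/
def liouville (q : CTB E M) : TangentSpace (ICTB E) q →L[ℝ] ℝ :=
  q.2.comp (mfderiv (ICTB E) 𝓘(ℝ, E) (TotalSpace.proj : CTB E M → M) q)

/-- The canonical symplectic form of `T*M`, the exterior derivative of the Liouville form. -/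
def canonicalSymplectic (q : CTB E M) (a b : TangentSpace (ICTB E) q) : ℝ :=
  extDerivOneForm (ICTB E) liouville q a b

namespace PseudoRiemannianMetric

variable (g : PseudoRiemannianMetric E M)

/-- The map `TM → T*M`, `v ↦ i_v T₂`, defined by the metric. -/
def flat (p : TB E M) : CTB E M := ⟨p.proj, g.val p.proj p.2⟩

/-- The symplectic form `ω₂` on `TM`: the pullback of the canonical one by `TM → T*M`. -/
def omega (p : TB E M) (a b : TangentSpace (ITB E) p) : ℝ :=
  canonicalSymplectic (g.flat p)
    (mfderiv (ITB E) (ICTB E) g.flat p a) (mfderiv (ITB E) (ICTB E) g.flat p b)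

/-- The kinetic energy `T(v) = T₂(v, v) / 2`. -/
def kinetic (p : TB E M) : ℝ := (1 / 2) * g.val p.proj p.2 p.2

/-- Newton's equation `i_D ω₂ + dT + α = 0` on `TM`. -/
def NewtonEquation (D : SecondOrderEquation E M) (α : HorizontalForm E M) : Prop :=
  ∀ (p : TB E M) (w : TangentSpace (ITB E) p),
    g.omega p (D.toFun p) w + mvfderiv (ITB E) g.kinetic p w + α.toFun p w = 0

/-- The equation `i_u d(i_u T₂) + dT(u) + u^*α = 0` on `M`, for a vector field `u` on `M`. -/
def IntermediateEquation (α : HorizontalForm E M)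
    (u : (x : M) → TangentSpace 𝓘(ℝ, E) x) : Prop :=
  ∀ (x : M) (w : TangentSpace 𝓘(ℝ, E) x),
    extDerivOneForm 𝓘(ℝ, E) (fun y ↦ g.val y (u y)) x (u x) w
      + mvfderiv 𝓘(ℝ, E) (fun y ↦ g.kinetic ⟨y, u y⟩) x w
      + α.toFun ⟨x, u x⟩
          (mfderiv 𝓘(ℝ, E) (ITB E) (fun y ↦ (⟨y, u y⟩ : TB E M)) x w) = 0

end PseudoRiemannianMetric

/-- A vector field `u` on `M` is an intermediate integral of `D` when `D` is tangent to the image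
of the section `u : M → TM`. -/
def IsIntermediateIntegral (D : SecondOrderEquation E M)
    (u : (x : M) → TangentSpace 𝓘(ℝ, E) x) : Prop :=
  ∀ x : M, ∃ w : TangentSpace 𝓘(ℝ, E) x,
    mfderiv 𝓘(ℝ, E) (ITB E) (fun y ↦ (⟨y, u y⟩ : TB E M)) x w = D.toFun ⟨x, u x⟩

end Mechanics

end Mechanics

end

/-! Read everything in a chart of `M` and the bundle charts it induces. Let `y` be the base
coordinate, `v` the fibre coordinate and `B` the matrix of the metric. The canonical form of `T*M`
is `dp ∧ dq`, and the metric map is `(y, v) ↦ (y, B(y) v)`. Hence for `a = (a₁, a₂)` and `b = (b₁,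
b₂)`, `ω₂(a, b) = DB(a₁)(v, b₁) + B(a₂, b₁) - DB(b₁)(v, a₁) - B(b₂, a₁)`, while `dT(b) = DB(b₁)(v,
v) / 2 + B(b₂, v)`. A second-order equation has `a₁ = v`, so the terms in `b₂` cancel in `i_D ω₂ +
dT`. This form is therefore horizontal, with components `B(a₂) + Γ`, where `Γ(w) = DB(v)(v, w) -
DB(w)(v, v) / 2` is `geodesicTerm`. Newton's equation becomes `B a₂ = -(Γ + α)` (`newton_iff`): it
gives `α` from `D` directly, and `D` from `α` because `B` is invertible. Both formulas are smooth in
a fixed chart.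

For a vector field with components `U`, the same cancellation and Newton's equation turn the left
side of the intermediate equation into the covector `B(DU(U) - a₂)`. By nondegeneracy it vanishes
exactly when `DU(U) = a₂`, which is the tangency of `D` to the image of `u`. -/

section Development

open Bundle Set
open scoped Manifold ContDiff Topology

noncomputable section

set_option maxSynthPendingDepth 3

namespace Mechanics

/-! ### Differentials and exterior derivatives read in charts -/

section Charts

variable {F H N : Type*} [NormedAddCommGroup F] [NormedSpace ℝ F]
  [TopologicalSpace H] (J : ModelWithCorners ℝ F H) [TopologicalSpace N] [ChartedSpace H N]

/-- The differential at `x` of the preferred chart around `x₁`. -/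
def chartD (x₁ x : N) : TangentSpace J x →L[ℝ] F :=
  mfderiv J 𝓘(ℝ, F) (extChartAt J x₁) x

/-- The inverse of the differential at `x` of the preferred chart around `x₁`. -/
def chartDInv (x₁ x : N) : F →L[ℝ] TangentSpace J x :=
  (chartD J x₁ x).inverse

variable {J}

section

variable [IsManifold J 1 N]

theorem isInvertible_chartD {x₁ x : N} (hx : x ∈ (chartAt H x₁).source) :
    (chartD J x₁ x).IsInvertible :=
  isInvertible_mfderiv_extChartAt (by simpa using hx)

theorem chartDInv_chartD {x₁ x : N} (hx : x ∈ (chartAt H x₁).source) (v : TangentSpace J x) :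
    chartDInv J x₁ x (chartD J x₁ x v) = v :=
  (isInvertible_chartD hx).inverse_apply_self v

theorem chartD_chartDInv {x₁ x : N} (hx : x ∈ (chartAt H x₁).source) (v : F) :
    chartD J x₁ x (chartDInv J x₁ x v) = v :=
  (isInvertible_chartD hx).self_apply_inverse v

theorem continuousLinearMapAt_eq_chartD {x₁ x : N} (hx : x ∈ (chartAt H x₁).source) :
    (trivializationAt F (TangentSpace J) x₁).continuousLinearMapAt ℝ x = chartD J x₁ x :=
  TangentBundle.continuousLinearMapAt_trivializationAt hx

theorem symmL_eq_chartDInv {x₁ x : N} (hx : x ∈ (chartAt H x₁).source) :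
    (trivializationAt F (TangentSpace J) x₁).symmL ℝ x = chartDInv J x₁ x := by
  ext v
  rw [← (trivializationAt F (TangentSpace J) x₁).symmL_continuousLinearMapAt (R := ℝ)
    (b := x) hx (chartDInv J x₁ x v), continuousLinearMapAt_eq_chartD hx, chartD_chartDInv hx]

end

/-- The chain rule for a map read in a chart. -/
theorem mfderiv_comp_eq_fderiv_chart {F' F'' H' N' : Type*} [NormedAddCommGroup F']
    [NormedSpace ℝ F'] [TopologicalSpace H'] {J' : ModelWithCorners ℝ F' H'}
    [TopologicalSpace N'] [ChartedSpace H' N'] [NormedAddCommGroup F''] [NormedSpace ℝ F'']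
    [IsManifold J 1 N]
    {x₁ x : N} (hx : x ∈ (chartAt H x₁).source) {f : N → N'} {k : N' → F''} {h : F → F''}
    (hf : MDifferentiableAt J J' f x) (hk : MDifferentiableAt J' 𝓘(ℝ, F'') k (f x))
    (hh : DifferentiableAt ℝ h (extChartAt J x₁ x))
    (heq : ∀ᶠ z in 𝓝 x, k (f z) = h (extChartAt J x₁ z)) (v : TangentSpace J x) :
    (mfderiv J' 𝓘(ℝ, F'') k (f x) (mfderiv J J' f x v) : F'') =
      fderiv ℝ h (extChartAt J x₁ x) (chartD J x₁ x v) := by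
  have h1 := mfderiv_comp x hk hf
  have h2 := mfderiv_comp x hh.mdifferentiableAt (mdifferentiableAt_extChartAt (I := J) hx)
  have h3 : mfderiv J 𝓘(ℝ, F'') (k ∘ f) x = mfderiv J 𝓘(ℝ, F'') (h ∘ extChartAt J x₁) x :=
    Filter.EventuallyEq.mfderiv_eq heq
  have h4 : ((mfderiv J' 𝓘(ℝ, F'') k (f x)).comp (mfderiv J J' f x) : F →L[ℝ] F'') =
      ((mfderiv 𝓘(ℝ, F) 𝓘(ℝ, F'') h (extChartAt J x₁ x)).comp (chartD J x₁ x) :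
        F →L[ℝ] F'') := (h1.symm.trans h3).trans h2
  rw [mfderiv_eq_fderiv] at h4
  exact DFunLike.congr_fun h4 v

/-- The differential of a vector-valued function read in a chart. -/
theorem mvfderiv_eq_fderiv_chart {F'' : Type*} [NormedAddCommGroup F''] [NormedSpace ℝ F'']
    [IsManifold J 1 N]
    {x₁ x : N} (hx : x ∈ (chartAt H x₁).source) {k : N → F''} {h : F → F''}
    (hh : DifferentiableAt ℝ h (extChartAt J x₁ x))
    (heq : ∀ᶠ z in 𝓝 x, k z = h (extChartAt J x₁ z)) (v : TangentSpace J x) :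
    mvfderiv J k x v = fderiv ℝ h (extChartAt J x₁ x) (chartD J x₁ x v) := by
  have h2 := mfderiv_comp x hh.mdifferentiableAt (mdifferentiableAt_extChartAt (I := J) hx)
  have h3 : mfderiv J 𝓘(ℝ, F'') k x = mfderiv J 𝓘(ℝ, F'') (h ∘ extChartAt J x₁) x :=
    Filter.EventuallyEq.mfderiv_eq heq
  have h4 : (mfderiv J 𝓘(ℝ, F'') k x : F →L[ℝ] F'') =
      ((mfderiv 𝓘(ℝ, F) 𝓘(ℝ, F'') h (extChartAt J x₁ x)).comp (chartD J x₁ x) :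
        F →L[ℝ] F'') := h3.trans h2
  rw [mfderiv_eq_fderiv] at h4
  exact DFunLike.congr_fun h4 v

/-- The exterior derivative of a 1-form on a vector space. -/
theorem extDeriv_ofSubsingleton {A : F → F →L[ℝ] ℝ} {y : F} (hA : DifferentiableAt ℝ A y)
    (v w : F) :
    extDeriv (fun z ↦ ContinuousAlternatingMap.ofSubsingleton ℝ F ℝ (0 : Fin 1) (A z)) y ![v, w] =
      fderiv ℝ A y v w - fderiv ℝ A y w v := by
  have hd : DifferentiableAt ℝ
      (fun z ↦ ContinuousAlternatingMap.ofSubsingleton ℝ F ℝ (0 : Fin 1) (A z)) y :=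
    ((ContinuousAlternatingMap.ofSubsingletonLIE (𝕜 := ℝ) (E := F) (F := ℝ)
      (0 : Fin 1)).toContinuousLinearEquiv.differentiableAt).comp y hA
  rw [extDeriv_apply hd]
  have e : ∀ a b : F, fderiv ℝ (fun z ↦ A z a) y b = fderiv ℝ A y b a := fun a b ↦ by
    rw [fderiv_clm_apply hA (differentiableAt_const a)]; simp
  simp [Fin.sum_univ_two, Fin.removeNth, e, sub_eq_add_neg]

variable [IsManifold J ∞ N]

/-- The differential of the inverse chart and `chartDInv` both describe the inverse of the tangent
trivialization, so they agree on the whole chart domain, not only at its centre. -/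
theorem chartForm_extChartAt (α : (x : N) → TangentSpace J x →L[ℝ] ℝ) {x₁ x : N}
    (hx : x ∈ (chartAt H x₁).source) :
    chartForm J α x₁ (extChartAt J x₁ x) =
      ContinuousAlternatingMap.ofSubsingleton ℝ F ℝ (0 : Fin 1)
        ((α x).comp (chartDInv J x₁ x)) := by
  have : IsManifold J 1 N := .of_le (n := ∞) (by simp)
  have h : (chartDInv J x₁ x : F →L[ℝ] F) =
      mfderivWithin 𝓘(ℝ, F) J (extChartAt J x₁).symm (range J) (extChartAt J x₁ x) :=
    (symmL_eq_chartDInv (J := J) hx).symm.trans (TangentBundle.symmL_trivializationAt hx)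
  have hl : (extChartAt J x₁).symm (extChartAt J x₁ x) = x :=
    (extChartAt J x₁).left_inv (by simpa using hx)
  -- All tangent spaces are definitionally the model space, so values of `α` at propositionally
  -- equal points can be compared without a cast.
  have h' : ∀ z, z = x → (α z : F →L[ℝ] ℝ) = α x := by rintro _ rfl; rfl
  unfold chartForm
  refine congrArg _ (?_ : ContinuousLinearMap.comp (M₁ := F) (M₂ := F) (M₃ := ℝ) _ _ =
    ContinuousLinearMap.comp (M₁ := F) (M₂ := F) (M₃ := ℝ) _ _)
  exact congrArg₂ _ (h' _ hl) h.symm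

variable [J.Boundaryless]

theorem contDiffAt_transition {x₀ x₁ z : N} (h₀ : z ∈ (chartAt H x₀).source)
    (h₁ : z ∈ (chartAt H x₁).source) :
    ContDiffAt ℝ ∞ (extChartAt J x₁ ∘ (extChartAt J x₀).symm) (extChartAt J x₀ z) := by
  have h := contDiffWithinAt_ext_coord_change (I := J) (n := ∞) x₁ x₀
    (y := extChartAt J x₀ z) (by
      rw [PartialEquiv.trans_source'', PartialEquiv.symm_symm, PartialEquiv.symm_target]
      exact mem_image_of_mem _ ⟨by simpa using h₀, by simpa using h₁⟩)
  rwa [J.range_eq_univ, contDiffWithinAt_univ] at h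

theorem chartD_eq_fderiv_transition {x₀ x₁ z : N} (h₀ : z ∈ (chartAt H x₀).source)
    (h₁ : z ∈ (chartAt H x₁).source) (v : TangentSpace J z) :
    chartD J x₁ z v = fderiv ℝ (extChartAt J x₁ ∘ (extChartAt J x₀).symm) (extChartAt J x₀ z)
      (chartD J x₀ z v) := by
  have : IsManifold J 1 N := .of_le (n := ∞) (by simp)
  refine mvfderiv_eq_fderiv_chart h₀
    ((contDiffAt_transition h₀ h₁).differentiableAt (by simp)) ?_ v
  filter_upwards [(chartAt H x₀).open_source.mem_nhds h₀] with y hy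
  simp only [Function.comp_apply]
  rw [(extChartAt J x₀).left_inv (by simpa using hy)]

/-- The exterior derivative of a 1-form, computed in an arbitrary preferred chart. -/
theorem extDerivOneForm_eq_fderiv {α : (x : N) → TangentSpace J x →L[ℝ] ℝ} {x₁ x : N}
    (hx : x ∈ (chartAt H x₁).source) {A : F → F →L[ℝ] ℝ}
    {A' : F →L[ℝ] F →L[ℝ] ℝ} (hA : HasFDerivAt A A' (extChartAt J x₁ x))
    (hα : ∀ᶠ z in 𝓝 x, ∀ v, α z v = A (extChartAt J x₁ z) (chartD J x₁ z v))
    (v w : TangentSpace J x) :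
    extDerivOneForm J α x v w =
      A' (chartD J x₁ x v) (chartD J x₁ x w) - A' (chartD J x₁ x w) (chartD J x₁ x v) := by
  have : IsManifold J 1 N := .of_le (n := ∞) (by simp)
  have hxx : x ∈ (chartAt H x).source := mem_chart_source H x
  set τ : F → F := extChartAt J x₁ ∘ (extChartAt J x).symm with hτ
  have hτx : τ (extChartAt J x x) = extChartAt J x₁ x := by simp [hτ]
  let Ω : F → F [⋀^Fin 1]→L[ℝ] ℝ :=
    fun y ↦ ContinuousAlternatingMap.ofSubsingleton ℝ F ℝ (0 : Fin 1) (A y)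
  have hΩ : DifferentiableAt ℝ Ω (τ (extChartAt J x x)) := by
    rw [hτx]
    exact ((ContinuousAlternatingMap.ofSubsingletonLIE (𝕜 := ℝ) (E := F) (F := ℝ)
      (0 : Fin 1)).toContinuousLinearEquiv.differentiableAt).comp _ hA.differentiableAt
  -- `extDerivOneForm` uses the chart centred at `x`. Near the centre, the local expression there is
  -- the pullback by the transition map `τ` of the expression in the chart at `x₁`; naturality of
  -- `extDeriv` then gives chart independence.
  have key : chartForm J α x =ᶠ[𝓝 (extChartAt J x x)]
      fun y ↦ (Ω (τ y)).compContinuousLinearMap (fderiv ℝ τ y) := by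
    have hc : Filter.Tendsto (extChartAt J x).symm (𝓝 (extChartAt J x x)) (𝓝 x) := by
      simpa using! (continuousAt_extChartAt_symm (I := J) x).tendsto
    filter_upwards [hc.eventually hα,
      hc.eventually ((chartAt H x).open_source.mem_nhds hxx),
      hc.eventually ((chartAt H x₁).open_source.mem_nhds hx),
      extChartAt_target_mem_nhds (I := J) x] with y h1 h2 h3 h4
    have hy : extChartAt J x ((extChartAt J x).symm y) = y := (extChartAt J x).right_inv h4
    conv_lhs => rw [← hy, chartForm_extChartAt α h2]
    ext u
    simp only [ContinuousAlternatingMap.ofSubsingleton_apply_apply,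
      ContinuousAlternatingMap.compContinuousLinearMap_apply, Ω, Function.comp_apply]
    refine (h1 _).trans ?_
    rw [chartD_eq_fderiv_transition h2 h3, hy]
    exact congrArg (fun a ↦ A (τ y) (fderiv ℝ τ y a)) (chartD_chartDInv (J := J) h2 (u 0))
  unfold extDerivOneForm
  rw [← hA.fderiv, J.range_eq_univ, extDerivWithin_univ, key.extDeriv_eq,
    extDeriv_pullback (r := ∞) hΩ (contDiffAt_transition hxx hx)
      (by simpa using! ENat.LEInfty.out), hτx,
    ContinuousAlternatingMap.compContinuousLinearMap_apply,
    chartD_eq_fderiv_transition hxx hx v, chartD_eq_fderiv_transition hxx hx w,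
    ← extDeriv_ofSubsingleton hA.differentiableAt]
  congr 1
  ext i
  fin_cases i <;> rfl

end Charts

/-! ### Trivializations and smoothness of sections in a fixed chart -/

section Sections

variable {F H N : Type*} [NormedAddCommGroup F] [NormedSpace ℝ F]
  [TopologicalSpace H] {J : ModelWithCorners ℝ F H} [TopologicalSpace N] [ChartedSpace H N]

theorem trivializationAt_tangent_eq [IsManifold J 1 N] {x₁ x : N}
    (hx : x ∈ (chartAt H x₁).source) (v : TangentSpace J x) :
    trivializationAt F (TangentSpace J) x₁ ⟨x, v⟩ = (x, chartD J x₁ x v) := by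
  rw [← continuousLinearMapAt_eq_chartD hx,
    Trivialization.continuousLinearMapAt_apply, Trivialization.linearMapAt_apply,
    if_pos (show x ∈ (trivializationAt F (TangentSpace J) x₁).baseSet from hx)]
  exact Prod.ext (Trivialization.coe_fst' _ hx) rfl

theorem trivializationAt_cotangent_eq [IsManifold J 1 N] {x₁ x : N}
    (hx : x ∈ (chartAt H x₁).source) (β : TangentSpace J x →L[ℝ] ℝ) :
    trivializationAt (F →L[ℝ] ℝ) (fun x : N ↦ TangentSpace J x →L[ℝ] ℝ) x₁ ⟨x, β⟩ =
      (x, β.comp (chartDInv J x₁ x)) := by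
  rw [hom_trivializationAt_apply, ← symmL_eq_chartDInv hx]
  refine Prod.ext rfl ?_
  ext v
  simp [ContinuousLinearMap.inCoordinates]

theorem trivializationAt_bilin_eq [IsManifold J 1 N] {x₁ x : N}
    (hx : x ∈ (chartAt H x₁).source) (β : TangentSpace J x →L[ℝ] TangentSpace J x →L[ℝ] ℝ)
    (v w : F) :
    (trivializationAt (F →L[ℝ] F →L[ℝ] ℝ)
      (fun x : N ↦ TangentSpace J x →L[ℝ] TangentSpace J x →L[ℝ] ℝ) x₁ ⟨x, β⟩).2 v w =
      β (chartDInv J x₁ x v) (chartDInv J x₁ x w) := by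
  rw [hom_trivializationAt_apply, ← symmL_eq_chartDInv hx]
  refine (inCoordinates_apply_eq₂ (E₁ := fun x : N ↦ TangentSpace J x)
    (E₂ := fun x : N ↦ TangentSpace J x) (E₃ := Bundle.Trivial N ℝ) (F₃ := ℝ) hx hx
    (mem_univ x)).trans ?_
  have hx' : x ∈ (trivializationAt F (TangentSpace J) x₁).baseSet := hx
  rw [Trivialization.symmL_apply _ hx', Trivialization.symmL_apply _ hx']
  simp

variable [IsManifold J ∞ N]

theorem contMDiffAt_vectorField_iff [IsManifold J 1 N] {X : (x : N) → TangentSpace J x} {x₁ x : N}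
    (hx : x ∈ (chartAt H x₁).source) :
    ContMDiffAt J J.tangent ∞ (fun x ↦ (⟨x, X x⟩ : TangentBundle J N)) x ↔
      ContMDiffAt J 𝓘(ℝ, F) ∞ (fun z ↦ chartD J x₁ z (X z)) x := by
  refine ((trivializationAt F (TangentSpace J) x₁).contMDiffAt_section_iff hx).trans
    (Filter.EventuallyEq.contMDiffAt_iff ?_)
  filter_upwards [(chartAt H x₁).open_source.mem_nhds hx] with z hz
  rw [trivializationAt_tangent_eq hz]

theorem contMDiffAt_oneForm_iff [IsManifold J 1 N] {α : (x : N) → TangentSpace J x →L[ℝ] ℝ}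
    {x₁ x : N} (hx : x ∈ (chartAt H x₁).source) :
    ContMDiffAt J (J.prod 𝓘(ℝ, F →L[ℝ] ℝ)) ∞ (fun x ↦ TotalSpace.mk' (F →L[ℝ] ℝ) x (α x)) x ↔
      ContMDiffAt J 𝓘(ℝ, F →L[ℝ] ℝ) ∞ (fun z ↦ (α z).comp (chartDInv J x₁ z)) x := by
  refine ((trivializationAt (F →L[ℝ] ℝ)
    (fun x : N ↦ TangentSpace J x →L[ℝ] ℝ) x₁).contMDiffAt_section_iff ⟨hx, trivial⟩).trans
    (Filter.EventuallyEq.contMDiffAt_iff ?_)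
  filter_upwards [(chartAt H x₁).open_source.mem_nhds hx] with z hz
  rw [trivializationAt_cotangent_eq hz]

end Sections

/-! ### Induced charts of the tangent and cotangent bundles, and the canonical symplectic form -/

section Bundles

variable {E M : Type*} [NormedAddCommGroup E] [NormedSpace ℝ E]
  [TopologicalSpace M] [ChartedSpace E M] [IsManifold 𝓘(ℝ, E) ∞ M]

theorem mem_chart_source_TB {p₁ p : TB E M} :
    p ∈ (chartAt (ModelProd E E) p₁).source ↔ p.proj ∈ (chartAt E p₁.proj).source :=
  TangentBundle.mem_chart_source_iff p p₁

theorem mem_chart_source_CTB {q₁ q : CTB E M} :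
    q ∈ (chartAt (ModelProd E (E →L[ℝ] ℝ)) q₁).source ↔
      q.proj ∈ (chartAt E q₁.proj).source := by
  simp only [FiberBundle.chartedSpace_chartAt, mfld_simps]
  simp only [hom_trivializationAt_apply]
  simp

theorem extChartAt_TB {p₁ p : TB E M} (hp : p.proj ∈ (chartAt E p₁.proj).source) :
    extChartAt (ITB E) p₁ p =
      (extChartAt 𝓘(ℝ, E) p₁.proj p.proj, chartD 𝓘(ℝ, E) p₁.proj p.proj p.2) := by
  rw [FiberBundle.extChartAt, PartialEquiv.trans_apply]
  have := trivializationAt_tangent_eq (J := 𝓘(ℝ, E)) hp p.2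
  exact congrArg ((extChartAt 𝓘(ℝ, E) p₁.proj).prod (PartialEquiv.refl E)) this

theorem extChartAt_CTB {q₁ q : CTB E M} (hq : q.proj ∈ (chartAt E q₁.proj).source) :
    extChartAt (ICTB E) q₁ q =
      (extChartAt 𝓘(ℝ, E) q₁.proj q.proj, q.2.comp (chartDInv 𝓘(ℝ, E) q₁.proj q.proj)) := by
  rw [FiberBundle.extChartAt, PartialEquiv.trans_apply]
  have := trivializationAt_cotangent_eq (J := 𝓘(ℝ, E)) hq q.2
  exact congrArg ((extChartAt 𝓘(ℝ, E) q₁.proj).prod (PartialEquiv.refl (E →L[ℝ] ℝ))) this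

theorem chartD_dProj {p₁ p : TB E M} (hp : p.proj ∈ (chartAt E p₁.proj).source)
    (w : TangentSpace (ITB E) p) :
    chartD 𝓘(ℝ, E) p₁.proj p.proj (dProj p w) = (chartD (ITB E) p₁ p w).1 := by
  refine (mfderiv_comp_eq_fderiv_chart (J := ITB E) (J' := 𝓘(ℝ, E)) (h := Prod.fst)
    (f := (TotalSpace.proj : TB E M → M))
    (mem_chart_source_TB.2 hp)
    ((contMDiffAt_proj (n := 1) (TangentSpace 𝓘(ℝ, E))).mdifferentiableAt one_ne_zero)
    (mdifferentiableAt_extChartAt hp) differentiableAt_fst ?_ w).trans ?_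
  · filter_upwards [(chartAt (ModelProd E E) p₁).open_source.mem_nhds
      (mem_chart_source_TB.2 hp)] with z hz
    rw [extChartAt_TB (mem_chart_source_TB.1 hz)]
  · rw [fderiv_fst]; rfl

theorem chartD_mfderiv_proj_CTB {q₁ q : CTB E M} (hq : q.proj ∈ (chartAt E q₁.proj).source)
    (w : TangentSpace (ICTB E) q) :
    chartD 𝓘(ℝ, E) q₁.proj q.proj
      (mfderiv (ICTB E) 𝓘(ℝ, E) (TotalSpace.proj : CTB E M → M) q w) =
      (chartD (ICTB E) q₁ q w).1 := by
  refine (mfderiv_comp_eq_fderiv_chart (J := ICTB E) (J' := 𝓘(ℝ, E)) (h := Prod.fst)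
    (f := (TotalSpace.proj : CTB E M → M))
    (mem_chart_source_CTB.2 hq)
    ((contMDiffAt_proj (n := 1)
      (fun x : M ↦ TangentSpace 𝓘(ℝ, E) x →L[ℝ] ℝ)).mdifferentiableAt one_ne_zero)
    (mdifferentiableAt_extChartAt hq) differentiableAt_fst ?_ w).trans ?_
  · filter_upwards [(chartAt (ModelProd E (E →L[ℝ] ℝ)) q₁).open_source.mem_nhds
      (mem_chart_source_CTB.2 hq)] with z hz
    rw [extChartAt_CTB (mem_chart_source_CTB.1 hz)]
  · rw [fderiv_fst]; rfl

/-- With `B` the identity this map is the coordinate expression `p dq` of the Liouville form. It is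
continuous linear, hence its own derivative. -/
theorem hasFDerivAt_comp_fst {V W : Type*} [NormedAddCommGroup V] [NormedSpace ℝ V]
    [NormedAddCommGroup W] [NormedSpace ℝ W] (B : W →L[ℝ] V →L[ℝ] ℝ) (y : V × W) :
    HasFDerivAt (fun z : V × W ↦ (B z.2).comp (ContinuousLinearMap.fst ℝ V W))
      (((ContinuousLinearMap.compL ℝ (V × W) V ℝ).flip
        (ContinuousLinearMap.fst ℝ V W)).comp (B.comp (ContinuousLinearMap.snd ℝ V W))) y :=
  ContinuousLinearMap.hasFDerivAt (((ContinuousLinearMap.compL ℝ (V × W) V ℝ).flip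
        (ContinuousLinearMap.fst ℝ V W)).comp (B.comp (ContinuousLinearMap.snd ℝ V W)))

/-- The canonical symplectic form of the cotangent bundle in the coordinates `(q, p)`. -/
theorem canonicalSymplectic_eq {q₁ q : CTB E M} (hq : q.proj ∈ (chartAt E q₁.proj).source)
    (a b : TangentSpace (ICTB E) q) :
    canonicalSymplectic q a b =
      (chartD (ICTB E) q₁ q a).2 (chartD (ICTB E) q₁ q b).1 -
        (chartD (ICTB E) q₁ q b).2 (chartD (ICTB E) q₁ q a).1 := by
  have hA := hasFDerivAt_comp_fst (ContinuousLinearMap.id ℝ (E →L[ℝ] ℝ)) (extChartAt (ICTB E) q₁ q)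
  have key := extDerivOneForm_eq_fderiv (J := ICTB E) (α := liouville)
    (mem_chart_source_CTB.2 hq) hA (by
      filter_upwards [(chartAt (ModelProd E (E →L[ℝ] ℝ)) q₁).open_source.mem_nhds
        (mem_chart_source_CTB.2 hq)] with z hz v
      have hz := mem_chart_source_CTB.1 hz
      rw [extChartAt_CTB hz, ContinuousLinearMap.comp_apply, ContinuousLinearMap.coe_fst',
        ← chartD_mfderiv_proj_CTB hz]
      exact congrArg z.2 (chartDInv_chartD hz _).symm) a b
  exact key

end Bundles

/-! ### The metric, the symplectic form and Newton's equation in coordinates -/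

section MetricCoordinates

section Calculus

variable {V W : Type*} [NormedAddCommGroup V] [NormedSpace ℝ V] [NormedAddCommGroup W]
  [NormedSpace ℝ W]

theorem hasFDerivAt_prodMk_apply {B : V → V →L[ℝ] W} {z : V × V}
    (hB : DifferentiableAt ℝ B z.1) :
    HasFDerivAt (fun z : V × V ↦ (z.1, B z.1 z.2))
      ((ContinuousLinearMap.fst ℝ V V).prod ((B z.1).comp (ContinuousLinearMap.snd ℝ V V) +
        ((fderiv ℝ B z.1).comp (ContinuousLinearMap.fst ℝ V V)).flip z.2)) z :=
  hasFDerivAt_fst.prodMk ((hB.hasFDerivAt.comp z hasFDerivAt_fst).clm_apply hasFDerivAt_snd)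

theorem hasFDerivAt_half_apply_apply {B : V → V →L[ℝ] V →L[ℝ] ℝ} {z : V × V}
    (hB : DifferentiableAt ℝ B z.1) :
    ∃ L : V × V →L[ℝ] ℝ, HasFDerivAt (fun z : V × V ↦ (1 / 2 : ℝ) * B z.1 z.2 z.2) L z ∧
      ∀ a, L a = (1 / 2) * (fderiv ℝ B z.1 a.1 z.2 z.2 + B z.1 a.2 z.2 + B z.1 z.2 a.2) := by
  refine ⟨_, (((hB.hasFDerivAt.comp z hasFDerivAt_fst).clm_apply hasFDerivAt_snd).clm_apply
    hasFDerivAt_snd).const_mul (1 / 2 : ℝ), fun a ↦ ?_⟩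
  simp
  ring

/-- The covector `w ↦ DB(v)(v, w) - DB(w)(v, v) / 2` at a point, for a field `B` of bilinear
forms. -/
def geodesicTerm (B : V → V →L[ℝ] V →L[ℝ] ℝ) (z : V × V) : V →L[ℝ] ℝ :=
  fderiv ℝ B z.1 z.2 z.2 - (1 / 2 : ℝ) • ((fderiv ℝ B z.1).flip z.2).flip z.2

theorem geodesicTerm_apply (B : V → V →L[ℝ] V →L[ℝ] ℝ) (z : V × V) (w : V) :
    geodesicTerm B z w = fderiv ℝ B z.1 z.2 z.2 w - (1 / 2) * fderiv ℝ B z.1 w z.2 z.2 :=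
  rfl

theorem contDiffAt_geodesicTerm {B : V → V →L[ℝ] V →L[ℝ] ℝ} {z : V × V}
    (hB : ContDiffAt ℝ ∞ B z.1) : ContDiffAt ℝ ∞ (geodesicTerm B) z := by
  have h : ContDiffAt ℝ ∞ (fun z : V × V ↦ fderiv ℝ B z.1) z :=
    ContDiffAt.comp (g := fderiv ℝ B) z (hB.fderiv_right (m := ∞) (by simp)) contDiffAt_fst
  have hf : ContDiffAt ℝ ∞ (fun z : V × V ↦ (fderiv ℝ B z.1).flip) z :=
    (ContinuousLinearMap.flipₗᵢ ℝ V V (V →L[ℝ] ℝ)).contDiff.contDiffAt.comp z h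
  have hf' : ContDiffAt ℝ ∞ (fun z : V × V ↦ ((fderiv ℝ B z.1).flip z.2).flip) z :=
    (ContinuousLinearMap.flipₗᵢ ℝ V V ℝ).contDiff.contDiffAt.comp z (hf.clm_apply contDiffAt_snd)
  exact ((h.clm_apply contDiffAt_snd).clm_apply contDiffAt_snd).sub
    ((hf'.clm_apply contDiffAt_snd).const_smul (1 / 2 : ℝ))

/-- This is Newton's equation solved for the form: `t.1` is the point `(y, v)` and `t.2.2` the
acceleration. It serves to prove `α` smooth. -/
theorem contDiffAt_formCoord {B : V → V →L[ℝ] V →L[ℝ] ℝ} {t : (V × V) × (V × V)}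
    (hB : ContDiffAt ℝ ∞ B t.1.1) :
    ContDiffAt ℝ ∞ (fun t : (V × V) × (V × V) ↦
      (-(geodesicTerm B t.1 + B t.1.1 t.2.2)).comp (ContinuousLinearMap.fst ℝ V V)) t := by
  have h1 := (contDiffAt_geodesicTerm hB).comp t contDiffAt_fst
  have h2 : ContDiffAt ℝ ∞ (fun t : (V × V) × (V × V) ↦ B t.1.1) t :=
    hB.comp t (contDiff_fst.comp contDiff_fst).contDiffAt
  have h3 : ContDiffAt ℝ ∞ (fun t : (V × V) × (V × V) ↦ t.2.2) t :=
    (contDiff_snd.comp contDiff_snd).contDiffAt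
  exact ((h1.add (h2.clm_apply h3)).neg).clm_comp contDiffAt_const

/-- This is Newton's equation solved for the vector field, with `t.2` the coordinate covector of
`α`. Smoothness rests on that of operator inversion, which is where completeness enters. -/
theorem contDiffAt_equationCoord [CompleteSpace V] {B : V → V →L[ℝ] V →L[ℝ] ℝ}
    {t : (V × V) × (V × V →L[ℝ] ℝ)} (hB : ContDiffAt ℝ ∞ B t.1.1)
    (hinv : (B t.1.1).IsInvertible) :
    ContDiffAt ℝ ∞ (fun t : (V × V) × (V × V →L[ℝ] ℝ) ↦
      (t.1.2, (B t.1.1).inverse (-(geodesicTerm B t.1 +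
        t.2.comp (ContinuousLinearMap.inl ℝ V V))))) t := by
  obtain ⟨e, he⟩ := hinv
  have hi : ContDiffAt ℝ ∞ ContinuousLinearMap.inverse (B t.1.1) := by
    rw [← he]
    exact contDiffAt_map_inverse e
  have h1 := (contDiffAt_geodesicTerm hB).comp t contDiffAt_fst
  have h2 : ContDiffAt ℝ ∞ (fun t : (V × V) × (V × V →L[ℝ] ℝ) ↦ B t.1.1) t :=
    hB.comp t (contDiff_fst.comp contDiff_fst).contDiffAt
  have h3 : ContDiffAt ℝ ∞ (fun t : (V × V) × (V × V →L[ℝ] ℝ) ↦ (B t.1.1).inverse) t :=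
    ContDiffAt.comp (g := ContinuousLinearMap.inverse) t hi h2
  exact (contDiff_snd.comp contDiff_fst).contDiffAt.prodMk
    (h3.clm_apply (h1.add (contDiffAt_snd.clm_comp contDiffAt_const)).neg)

end Calculus

variable {E M : Type*} [NormedAddCommGroup E] [NormedSpace ℝ E]
  [TopologicalSpace M] [ChartedSpace E M] [IsManifold 𝓘(ℝ, E) ∞ M]

/-- Replacing the fibre component of `w` by zero changes `w` by a vector with zero base component,
which is vertical because the projection is the first coordinate. -/
theorem horizontal_apply {p₁ p : TB E M}
    (hp : p.proj ∈ (chartAt E p₁.proj).source) {a : TangentSpace (ITB E) p →L[ℝ] ℝ}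
    (ha : ∀ V, IsVertical p V → a V = 0) (w : TangentSpace (ITB E) p) :
    a w = a (chartDInv (ITB E) p₁ p ((chartD (ITB E) p₁ p w).1, 0)) := by
  rw [← sub_eq_zero, ← map_sub]
  refine ha _ ?_
  have h := chartD_dProj hp (w - chartDInv (ITB E) p₁ p ((chartD (ITB E) p₁ p w).1, 0))
  rw [map_sub (chartD (ITB E) p₁ p), chartD_chartDInv (mem_chart_source_TB.2 hp)] at h
  rw [IsVertical, ← chartDInv_chartD hp (dProj p _), h]
  simp

theorem contDiffAt_comp_extChartAt_symm {V : Type*} [NormedAddCommGroup V] [NormedSpace ℝ V]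
    {f : M → V} {x₁ x : M} (hx : x ∈ (chartAt E x₁).source)
    (hf : ContMDiffAt 𝓘(ℝ, E) 𝓘(ℝ, V) ∞ f x) :
    ContDiffAt ℝ ∞ (fun y ↦ f ((extChartAt 𝓘(ℝ, E) x₁).symm y)) (extChartAt 𝓘(ℝ, E) x₁ x) := by
  have hx' : x ∈ (extChartAt 𝓘(ℝ, E) x₁).source := by simpa using hx
  have h := (contMDiffOn_extChartAt_symm (I := 𝓘(ℝ, E)) (n := ∞) x₁).contMDiffAt
    (extChartAt_target_mem_nhds' ((extChartAt 𝓘(ℝ, E) x₁).map_source hx'))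
  refine ContMDiffAt.contDiffAt (ContMDiffAt.comp (I' := 𝓘(ℝ, E)) _ (g := f) ?_ h)
  rwa [(extChartAt 𝓘(ℝ, E) x₁).left_inv hx']

namespace PseudoRiemannianMetric

variable (g : PseudoRiemannianMetric E M)

/-- The matrix of the metric in the preferred chart around `x₁`. -/
def coord (x₁ : M) (y : E) : E →L[ℝ] E →L[ℝ] ℝ :=
  (trivializationAt (E →L[ℝ] E →L[ℝ] ℝ)
    (fun x : M ↦ TangentSpace 𝓘(ℝ, E) x →L[ℝ] TangentSpace 𝓘(ℝ, E) x →L[ℝ] ℝ) x₁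
      ⟨(extChartAt 𝓘(ℝ, E) x₁).symm y, g.val ((extChartAt 𝓘(ℝ, E) x₁).symm y)⟩).2

variable {g}

theorem coord_extChartAt {x₁ x : M} (hx : x ∈ (chartAt E x₁).source) (v w : E) :
    g.coord x₁ (extChartAt 𝓘(ℝ, E) x₁ x) v w =
      g.val x (chartDInv 𝓘(ℝ, E) x₁ x v) (chartDInv 𝓘(ℝ, E) x₁ x w) := by
  rw [← trivializationAt_bilin_eq hx, coord, (extChartAt 𝓘(ℝ, E) x₁).left_inv (by simpa using hx)]

theorem coord_chartD {x₁ x : M} (hx : x ∈ (chartAt E x₁).source)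
    (v w : TangentSpace 𝓘(ℝ, E) x) :
    g.coord x₁ (extChartAt 𝓘(ℝ, E) x₁ x) (chartD 𝓘(ℝ, E) x₁ x v) (chartD 𝓘(ℝ, E) x₁ x w) =
      g.val x v w := by
  rw [coord_extChartAt hx, chartDInv_chartD hx, chartDInv_chartD hx]

theorem coord_symm {x₁ x : M} (hx : x ∈ (chartAt E x₁).source) (v w : E) :
    g.coord x₁ (extChartAt 𝓘(ℝ, E) x₁ x) v w = g.coord x₁ (extChartAt 𝓘(ℝ, E) x₁ x) w v := by
  rw [coord_extChartAt hx, coord_extChartAt hx, g.symm]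

theorem coord_injective {x₁ x : M} (hx : x ∈ (chartAt E x₁).source) :
    Function.Injective (g.coord x₁ (extChartAt 𝓘(ℝ, E) x₁ x)) := by
  rw [injective_iff_map_eq_zero]
  intro v hv
  have h : chartDInv 𝓘(ℝ, E) x₁ x v = 0 := g.nondegenerate x _ fun w ↦ by
    have := coord_extChartAt (g := g) hx v (chartD 𝓘(ℝ, E) x₁ x w)
    rw [chartDInv_chartD hx, hv] at this
    exact this.symm
  rw [← chartD_chartDInv (J := 𝓘(ℝ, E)) hx v, h, map_zero]

/-- Nondegeneracy only gives injectivity into the dual; equality of dimensions makes it an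
isomorphism. -/
theorem coord_isInvertible [FiniteDimensional ℝ E] {x₁ x : M} (hx : x ∈ (chartAt E x₁).source) :
    (g.coord x₁ (extChartAt 𝓘(ℝ, E) x₁ x)).IsInvertible := by
  have hdim : Module.finrank ℝ E = Module.finrank ℝ (E →L[ℝ] ℝ) := by
    rw [← (LinearMap.toContinuousLinearMap (𝕜 := ℝ) (E := E) (F' := ℝ)).finrank_eq]
    exact Subspace.dual_finrank_eq.symm
  refine ⟨(LinearEquiv.ofInjectiveOfFinrankEq
    (g.coord x₁ (extChartAt 𝓘(ℝ, E) x₁ x)).toLinearMap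
    (coord_injective hx) hdim).toContinuousLinearEquiv, ?_⟩
  ext v w
  rfl

theorem contDiffAt_coord {x₁ x : M} (hx : x ∈ (chartAt E x₁).source) :
    ContDiffAt ℝ ∞ (g.coord x₁) (extChartAt 𝓘(ℝ, E) x₁ x) := by
  refine contDiffAt_comp_extChartAt_symm (f := fun x ↦ (trivializationAt (E →L[ℝ] E →L[ℝ] ℝ)
    (fun x : M ↦ TangentSpace 𝓘(ℝ, E) x →L[ℝ] TangentSpace 𝓘(ℝ, E) x →L[ℝ] ℝ) x₁
      ⟨x, g.val x⟩).2) hx ?_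
  exact ((trivializationAt (E →L[ℝ] E →L[ℝ] ℝ)
    (fun x : M ↦ TangentSpace 𝓘(ℝ, E) x →L[ℝ] TangentSpace 𝓘(ℝ, E) x →L[ℝ] ℝ)
      x₁).contMDiffAt_section_iff (show x ∈ (chartAt E x₁).source ∩
        ((chartAt E x₁).source ∩ univ) from ⟨hx, hx, mem_univ x⟩)).1 (g.smooth x)

theorem differentiableAt_coord {x₁ x : M} (hx : x ∈ (chartAt E x₁).source) :
    DifferentiableAt ℝ (g.coord x₁) (extChartAt 𝓘(ℝ, E) x₁ x) :=
  (contDiffAt_coord hx).differentiableAt (by simp)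

theorem contMDiff_flat : ContMDiff (ITB E) (ICTB E) ∞ g.flat := by
  have h1 : ContMDiff (ITB E) (𝓘(ℝ, E).prod 𝓘(ℝ, E →L[ℝ] E →L[ℝ] ℝ)) ∞
      (fun p : TB E M ↦ TotalSpace.mk' (E →L[ℝ] E →L[ℝ] ℝ)
        (E := fun x : M ↦ TangentSpace 𝓘(ℝ, E) x →L[ℝ] TangentSpace 𝓘(ℝ, E) x →L[ℝ] ℝ)
        p.proj (g.val p.proj)) :=
    g.smooth.comp (contMDiff_proj (TangentSpace 𝓘(ℝ, E)))
  have h2 : ContMDiff (ITB E) (ITB E) ∞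
      (fun p : TB E M ↦ TotalSpace.mk' E (E := TangentSpace 𝓘(ℝ, E)) p.proj p.2) := contMDiff_id
  exact ContMDiff.clm_bundle_apply
    (E₁ := fun x : M ↦ TangentSpace 𝓘(ℝ, E) x)
    (E₂ := fun x : M ↦ TangentSpace 𝓘(ℝ, E) x →L[ℝ] ℝ) h1 h2

theorem extChartAt_flat {p₁ p : TB E M} (hp : p.proj ∈ (chartAt E p₁.proj).source) :
    extChartAt (ICTB E) (g.flat p₁) (g.flat p) =
      ((extChartAt (ITB E) p₁ p).1,
        g.coord p₁.proj (extChartAt (ITB E) p₁ p).1 (extChartAt (ITB E) p₁ p).2) := by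
  rw [extChartAt_CTB (q₁ := g.flat p₁) (q := g.flat p) hp, extChartAt_TB hp]
  refine Prod.ext rfl ?_
  ext w
  have h := coord_extChartAt (g := g) hp (chartD 𝓘(ℝ, E) p₁.proj p.proj p.2) w
  rw [chartDInv_chartD hp] at h
  exact h.symm

theorem chartD_mfderiv_flat {p₁ p : TB E M} (hp : p.proj ∈ (chartAt E p₁.proj).source)
    (a : TangentSpace (ITB E) p) :
    chartD (ICTB E) (g.flat p₁) (g.flat p) (mfderiv (ITB E) (ICTB E) g.flat p a) =
      ((chartD (ITB E) p₁ p a).1,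
        fderiv ℝ (g.coord p₁.proj) (extChartAt (ITB E) p₁ p).1 (chartD (ITB E) p₁ p a).1
            (extChartAt (ITB E) p₁ p).2 +
          g.coord p₁.proj (extChartAt (ITB E) p₁ p).1 (chartD (ITB E) p₁ p a).2) := by
  have hh := hasFDerivAt_prodMk_apply (B := g.coord p₁.proj) (z := extChartAt (ITB E) p₁ p) (by
    rw [extChartAt_TB hp]
    exact differentiableAt_coord hp)
  refine (mfderiv_comp_eq_fderiv_chart (J := ITB E) (J' := ICTB E) (mem_chart_source_TB.2 hp)
    (contMDiff_flat.mdifferentiableAt (by simp))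
    (mdifferentiableAt_extChartAt (I := ICTB E)
      (mem_chart_source_CTB (q₁ := g.flat p₁) (q := g.flat p).2 hp))
    hh.differentiableAt ?_ a).trans ?_
  · filter_upwards [(chartAt (ModelProd E E) p₁).open_source.mem_nhds
      (mem_chart_source_TB.2 hp)] with z hz
    exact extChartAt_flat (mem_chart_source_TB.1 hz)
  · rw [hh.fderiv]
    refine Prod.ext rfl ?_
    exact add_comm _ _

/-- The symplectic form of the tangent bundle in coordinates. -/
theorem omega_eq {p₁ p : TB E M} (hp : p.proj ∈ (chartAt E p₁.proj).source)
    (a b : TangentSpace (ITB E) p) {y v : E} (hyv : extChartAt (ITB E) p₁ p = (y, v))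
    {a₁ a₂ b₁ b₂ : E} (ha : chartD (ITB E) p₁ p a = (a₁, a₂))
    (hb : chartD (ITB E) p₁ p b = (b₁, b₂)) :
    g.omega p a b =
      (fderiv ℝ (g.coord p₁.proj) y a₁ v b₁ + g.coord p₁.proj y a₂ b₁) -
        (fderiv ℝ (g.coord p₁.proj) y b₁ v a₁ + g.coord p₁.proj y b₂ a₁) := by
  have h := canonicalSymplectic_eq (q₁ := g.flat p₁) (q := g.flat p) hp
    (mfderiv (ITB E) (ICTB E) g.flat p a) (mfderiv (ITB E) (ICTB E) g.flat p b)
  rw [chartD_mfderiv_flat hp, chartD_mfderiv_flat hp, ha, hb, hyv] at h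
  exact h

/-- The differential of the kinetic energy in coordinates. -/
theorem mvfderiv_kinetic_eq {p₁ p : TB E M} (hp : p.proj ∈ (chartAt E p₁.proj).source)
    (b : TangentSpace (ITB E) p) {y v : E} (hyv : extChartAt (ITB E) p₁ p = (y, v))
    {b₁ b₂ : E} (hb : chartD (ITB E) p₁ p b = (b₁, b₂)) :
    mvfderiv (ITB E) g.kinetic p b =
      (1 / 2) * fderiv ℝ (g.coord p₁.proj) y b₁ v v + g.coord p₁.proj y b₂ v := by
  have hy : y = extChartAt 𝓘(ℝ, E) p₁.proj p.proj := by
    rw [extChartAt_TB hp] at hyv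
    exact (congrArg Prod.fst hyv).symm
  obtain ⟨L, hL, hLa⟩ := hasFDerivAt_half_apply_apply (B := g.coord p₁.proj) (z := (y, v)) (by
    rw [hy]
    exact differentiableAt_coord hp)
  rw [mvfderiv_eq_fderiv_chart (J := ITB E) (mem_chart_source_TB.2 hp)
    (h := fun z : E × E ↦ (1 / 2 : ℝ) * g.coord p₁.proj z.1 z.2 z.2)
    (by rw [hyv]; exact hL.differentiableAt) ?_ b, hyv, hb, hL.fderiv, hLa]
  · have hs : g.coord p₁.proj y v b₂ = g.coord p₁.proj y b₂ v := by rw [hy, coord_symm hp]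
    simp only [hs]
    ring
  · filter_upwards [(chartAt (ModelProd E E) p₁).open_source.mem_nhds
      (mem_chart_source_TB.2 hp)] with z hz
    have hz := mem_chart_source_TB.1 hz
    rw [extChartAt_TB hz, coord_chartD hz, kinetic]

/-- Newton's equation at a point, in coordinates. -/
theorem newton_iff {p₁ p : TB E M} (hp : p.proj ∈ (chartAt E p₁.proj).source)
    {d : TangentSpace (ITB E) p} (hd : dProj p d = p.2) {a : TangentSpace (ITB E) p →L[ℝ] ℝ}
    (ha : ∀ V, IsVertical p V → a V = 0) :
    (∀ w, g.omega p d w + mvfderiv (ITB E) g.kinetic p w + a w = 0) ↔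
      g.coord p₁.proj (extChartAt 𝓘(ℝ, E) p₁.proj p.proj) (chartD (ITB E) p₁ p d).2 =
        -(geodesicTerm (g.coord p₁.proj) (extChartAt (ITB E) p₁ p) +
          (a.comp (chartDInv (ITB E) p₁ p)).comp (ContinuousLinearMap.inl ℝ E E)) := by
  have hps := mem_chart_source_TB.2 hp
  have hd₁ : (chartD (ITB E) p₁ p d).1 = (extChartAt (ITB E) p₁ p).2 := by
    rw [← chartD_dProj hp, hd, extChartAt_TB hp]
  have hy₁ : extChartAt 𝓘(ℝ, E) p₁.proj p.proj = (extChartAt (ITB E) p₁ p).1 := by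
    rw [extChartAt_TB hp]
  have key : ∀ w, g.omega p d w + mvfderiv (ITB E) g.kinetic p w + a w =
      (g.coord p₁.proj (extChartAt 𝓘(ℝ, E) p₁.proj p.proj) (chartD (ITB E) p₁ p d).2 +
        (geodesicTerm (g.coord p₁.proj) (extChartAt (ITB E) p₁ p) +
          (a.comp (chartDInv (ITB E) p₁ p)).comp (ContinuousLinearMap.inl ℝ E E)))
        (chartD (ITB E) p₁ p w).1 := fun w ↦ by
    rw [omega_eq (g := g) hp d w (y := (extChartAt (ITB E) p₁ p).1)
      (v := (extChartAt (ITB E) p₁ p).2) (a₁ := (chartD (ITB E) p₁ p d).1)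
      (a₂ := (chartD (ITB E) p₁ p d).2) (b₁ := (chartD (ITB E) p₁ p w).1)
      (b₂ := (chartD (ITB E) p₁ p w).2) rfl rfl rfl,
      mvfderiv_kinetic_eq (g := g) hp w (y := (extChartAt (ITB E) p₁ p).1)
      (v := (extChartAt (ITB E) p₁ p).2) (b₁ := (chartD (ITB E) p₁ p w).1)
      (b₂ := (chartD (ITB E) p₁ p w).2) rfl rfl, horizontal_apply hp ha w,
      hd₁, hy₁]
    -- After substituting `a₁ = v`, the two terms in the fibre component of `w` cancel, and `-1 +
    -- 1/2` leaves the coefficient `-1/2` of `geodesicTerm`.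
    simp [geodesicTerm_apply]
    ring
  rw [eq_neg_iff_add_eq_zero]
  refine ⟨fun h ↦ ?_, fun h w ↦ by rw [key, h]; simp⟩
  ext e
  have h1 := h (chartDInv (ITB E) p₁ p (e, 0))
  rw [key, chartD_chartDInv hps] at h1
  exact h1

end PseudoRiemannianMetric

end MetricCoordinates

/-! ### The bijection between second-order equations and horizontal forms -/

section NewtonBijection

variable {E M : Type*} [NormedAddCommGroup E] [NormedSpace ℝ E]
  [TopologicalSpace M] [ChartedSpace E M] [IsManifold 𝓘(ℝ, E) ∞ M]

namespace PseudoRiemannianMetric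

variable (g : PseudoRiemannianMetric E M)

theorem exists_form_of_equation (D : SecondOrderEquation E M) :
    ∃ α : HorizontalForm E M, g.NewtonEquation D α := by
  -- The components that `newton_iff` forces on `α`, in the chart at `p₁`. The form itself is
  -- defined at each `p` with the chart centred at `p`.
  let c : (p₁ p : TB E M) → E →L[ℝ] ℝ := fun p₁ p ↦
    -(geodesicTerm (g.coord p₁.proj) (extChartAt (ITB E) p₁ p) +
      g.coord p₁.proj (extChartAt (ITB E) p₁ p).1 (chartD (ITB E) p₁ p (D.toFun p)).2)
  let α : (p : TB E M) → TangentSpace (ITB E) p →L[ℝ] ℝ := fun p ↦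
    (c p p).comp ((ContinuousLinearMap.fst ℝ E E).comp (chartD (ITB E) p p))
  have hα : ∀ p w, α p w = c p p (chartD (ITB E) p p w).1 := fun p w ↦ rfl
  have hor : IsHorizontal α := fun p V hV ↦ by
    rw [hα, ← chartD_dProj (mem_chart_source E p.proj), show dProj p V = 0 from hV, map_zero,
      map_zero]
  have newton : ∀ p w, g.omega p (D.toFun p) w + mvfderiv (ITB E) g.kinetic p w + α p w = 0 :=
    fun p ↦ by
      refine (newton_iff (p₁ := p) (mem_chart_source E p.proj) (D.proj_eq p) (hor p)).2 ?_
      have : ((α p).comp (chartDInv (ITB E) p p)).comp (ContinuousLinearMap.inl ℝ E E) =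
          c p p := by
        ext e
        have h := hα p (chartDInv (ITB E) p p (e, 0))
        rw [chartD_chartDInv (mem_chart_source (ModelProd E E) p)] at h
        exact h
      rw [this]
      simp only [c]
      rw [extChartAt_TB (mem_chart_source E p.proj)]
      abel
  -- The chart used to define `α` moves with `p`, so smoothness is not visible there. Newton's
  -- equation is intrinsic, so it yields the same formula in the fixed chart at `p₁`.
  have hcoord : ∀ p₁ p : TB E M, p.proj ∈ (chartAt E p₁.proj).source →
      (α p).comp (chartDInv (ITB E) p₁ p) =
        (c p₁ p).comp (ContinuousLinearMap.fst ℝ E E) := fun p₁ p hp ↦ by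
    have h := (newton_iff hp (D.proj_eq p) (hor p)).1 (newton p)
    have h' : c p₁ p = ((α p).comp (chartDInv (ITB E) p₁ p)).comp
        (ContinuousLinearMap.inl ℝ E E) := by
      simp only [c]
      rw [show (extChartAt (ITB E) p₁ p).1 = extChartAt 𝓘(ℝ, E) p₁.proj p.proj by
        rw [extChartAt_TB hp], h]
      abel
    rw [h']
    refine ContinuousLinearMap.ext fun e ↦ ?_
    have := horizontal_apply hp (hor p) (chartDInv (ITB E) p₁ p e)
    rw [chartD_chartDInv (mem_chart_source_TB.2 hp)] at this
    exact this
  refine ⟨⟨α, fun p₁ ↦ ?_, hor⟩, newton⟩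
  have hs : p₁ ∈ (chartAt (ModelProd E E) p₁).source := mem_chart_source _ p₁
  refine (contMDiffAt_oneForm_iff hs).2 ?_
  have hD := (contMDiffAt_vectorField_iff hs).1 (D.smooth p₁)
  have hΦ : ContMDiffAt (ITB E) 𝓘(ℝ, E × E) ∞ (extChartAt (ITB E) p₁) p₁ := contMDiffAt_extChartAt
  have hpair := hΦ.prodMk_space hD
  have hB : ContDiffAt ℝ ∞ (g.coord p₁.proj) (extChartAt (ITB E) p₁ p₁).1 := by
    rw [extChartAt_TB (mem_chart_source E p₁.proj)]
    exact contDiffAt_coord (mem_chart_source E p₁.proj)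
  have hh := contDiffAt_formCoord
    (t := (extChartAt (ITB E) p₁ p₁, chartD (ITB E) p₁ p₁ (D.toFun p₁))) hB
  refine (ContMDiffAt.comp (I' := 𝓘(ℝ, (E × E) × (E × E))) p₁ hh.contMDiffAt
    hpair).congr_of_eventuallyEq ?_
  filter_upwards [(chartAt (ModelProd E E) p₁).open_source.mem_nhds hs] with p hp
  exact hcoord p₁ p (mem_chart_source_TB.1 hp)

theorem exists_equation_of_form [FiniteDimensional ℝ E] (α : HorizontalForm E M) :
    ∃ D : SecondOrderEquation E M, g.NewtonEquation D α := by
  have : CompleteSpace E := FiniteDimensional.complete ℝ E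
  let f : (p₁ p : TB E M) → E := fun p₁ p ↦
    (g.coord p₁.proj (extChartAt (ITB E) p₁ p).1).inverse
      (-(geodesicTerm (g.coord p₁.proj) (extChartAt (ITB E) p₁ p) +
        ((α.toFun p).comp (chartDInv (ITB E) p₁ p)).comp (ContinuousLinearMap.inl ℝ E E)))
  let D : (p : TB E M) → TangentSpace (ITB E) p := fun p ↦
    chartDInv (ITB E) p p ((extChartAt (ITB E) p p).2, f p p)
  have hD : ∀ p, chartD (ITB E) p p (D p) = ((extChartAt (ITB E) p p).2, f p p) := fun p ↦
    chartD_chartDInv (mem_chart_source (ModelProd E E) p) _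
  have proj_eq : ∀ p, dProj p (D p) = p.2 := fun p ↦ by
    rw [← chartDInv_chartD (mem_chart_source E p.proj) (dProj p (D p)),
      chartD_dProj (mem_chart_source E p.proj), hD, extChartAt_TB (mem_chart_source E p.proj),
      chartDInv_chartD (mem_chart_source E p.proj)]
  have newton : ∀ p w,
      g.omega p (D p) w + mvfderiv (ITB E) g.kinetic p w + α.toFun p w = 0 := fun p ↦ by
    refine (newton_iff (p₁ := p) (mem_chart_source E p.proj) (proj_eq p) (α.horizontal p)).2 ?_
    rw [hD]
    simp only [f]
    rw [show (extChartAt (ITB E) p p).1 = extChartAt 𝓘(ℝ, E) p.proj p.proj by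
      rw [extChartAt_TB (mem_chart_source E p.proj)]]
    exact (coord_isInvertible (mem_chart_source E p.proj)).self_apply_inverse _
  -- As for the form, the intrinsic equation transfers the formula for `D` to a fixed chart, where
  -- smoothness can be tested.
  have hcoord : ∀ p₁ p : TB E M, p.proj ∈ (chartAt E p₁.proj).source →
      chartD (ITB E) p₁ p (D p) = ((extChartAt (ITB E) p₁ p).2, f p₁ p) := fun p₁ p hp ↦ by
    have h := (newton_iff hp (proj_eq p) (α.horizontal p)).1 (newton p)
    refine Prod.ext ?_ ?_
    · rw [← chartD_dProj hp, proj_eq, extChartAt_TB hp]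
    · simp only [f]
      rw [← h, show (extChartAt (ITB E) p₁ p).1 = extChartAt 𝓘(ℝ, E) p₁.proj p.proj by
        rw [extChartAt_TB hp]]
      exact ((coord_isInvertible hp).inverse_apply_self _).symm
  refine ⟨⟨D, fun p₁ ↦ ?_, proj_eq⟩, newton⟩
  have hs : p₁ ∈ (chartAt (ModelProd E E) p₁).source := mem_chart_source _ p₁
  refine (contMDiffAt_vectorField_iff hs).2 ?_
  have hα := (contMDiffAt_oneForm_iff hs).1 (α.smooth p₁)
  have hΦ : ContMDiffAt (ITB E) 𝓘(ℝ, E × E) ∞ (extChartAt (ITB E) p₁) p₁ := contMDiffAt_extChartAt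
  have hpair := hΦ.prodMk_space hα
  have hB : ContDiffAt ℝ ∞ (g.coord p₁.proj) (extChartAt (ITB E) p₁ p₁).1 := by
    rw [extChartAt_TB (mem_chart_source E p₁.proj)]
    exact contDiffAt_coord (mem_chart_source E p₁.proj)
  have hh := contDiffAt_equationCoord
    (t := (extChartAt (ITB E) p₁ p₁, (α.toFun p₁).comp (chartDInv (ITB E) p₁ p₁))) hB (by
      rw [extChartAt_TB (mem_chart_source E p₁.proj)]
      exact coord_isInvertible (mem_chart_source E p₁.proj))
  refine (ContMDiffAt.comp (I' := 𝓘(ℝ, (E × E) × (E × E →L[ℝ] ℝ))) p₁ hh.contMDiffAt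
    hpair).congr_of_eventuallyEq ?_
  filter_upwards [(chartAt (ModelProd E E) p₁).open_source.mem_nhds hs] with p hp
  exact hcoord p₁ p (mem_chart_source_TB.1 hp)

variable {g}

theorem NewtonEquation.form_unique {D : SecondOrderEquation E M} {α β : HorizontalForm E M}
    (hα : g.NewtonEquation D α) (hβ : g.NewtonEquation D β) : α = β := by
  have h : α.toFun = β.toFun := by
    funext p
    ext w
    exact add_left_cancel ((hα p w).trans (hβ p w).symm)
  cases α
  cases β
  congr

/-- The base component is fixed by the second-order condition, the fibre component by injectivity of
the metric matrix. -/
theorem NewtonEquation.equation_unique {D D' : SecondOrderEquation E M} {α : HorizontalForm E M}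
    (hD : g.NewtonEquation D α) (hD' : g.NewtonEquation D' α) : D = D' := by
  have h : D.toFun = D'.toFun := by
    funext p
    have hp := mem_chart_source E p.proj
    have h1 := (newton_iff hp (D.proj_eq p) (α.horizontal p)).1 (hD p)
    have h2 := (newton_iff hp (D'.proj_eq p) (α.horizontal p)).1 (hD' p)
    have h3 : chartD (ITB E) p p (D.toFun p) = chartD (ITB E) p p (D'.toFun p) := by
      refine Prod.ext ?_ (coord_injective hp (h1.trans h2.symm))
      rw [← chartD_dProj hp, ← chartD_dProj hp, D.proj_eq, D'.proj_eq]
    rw [← chartDInv_chartD (mem_chart_source (ModelProd E E) p) (D.toFun p), h3,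
      chartDInv_chartD (mem_chart_source (ModelProd E E) p)]
  cases D
  cases D'
  congr

variable (g) in
theorem exists_equiv_newtonEquation [FiniteDimensional ℝ E] :
    ∃ e : SecondOrderEquation E M ≃ HorizontalForm E M,
      ∀ (D : SecondOrderEquation E M) (α : HorizontalForm E M),
        e D = α ↔ g.NewtonEquation D α := by
  choose a ha using g.exists_form_of_equation
  choose d hd using g.exists_equation_of_form
  exact ⟨⟨a, d, fun D ↦ (hd (a D)).equation_unique (ha D),
    fun α ↦ (ha (d α)).form_unique (hd α)⟩,
    fun D α ↦ ⟨fun h ↦ h ▸ ha D, fun h ↦ (ha D).form_unique h⟩⟩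

end PseudoRiemannianMetric

end NewtonBijection

/-! ### Intermediate integrals -/

section IntermediateIntegrals

variable {E M : Type*} [NormedAddCommGroup E] [NormedSpace ℝ E]
  [TopologicalSpace M] [ChartedSpace E M]

theorem hasFDerivAt_clm_apply_self {V W : Type*} [NormedAddCommGroup V] [NormedSpace ℝ V]
    [NormedAddCommGroup W] [NormedSpace ℝ W] {B : V → V →L[ℝ] W} {U : V → V} {y : V}
    (hB : DifferentiableAt ℝ B y) (hU : DifferentiableAt ℝ U y) :
    ∃ L : V →L[ℝ] W, HasFDerivAt (fun z ↦ B z (U z)) L y ∧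
      ∀ a, L a = fderiv ℝ B y a (U y) + B y (fderiv ℝ U y a) :=
  ⟨_, hB.hasFDerivAt.clm_apply hU.hasFDerivAt, fun a ↦ by simp [add_comm]⟩

/-- The components of a vector field on `M` in the preferred chart around `x₁`. -/
def vectorFieldCoord (u : (x : M) → TangentSpace 𝓘(ℝ, E) x) (x₁ : M) (y : E) : E :=
  chartD 𝓘(ℝ, E) x₁ ((extChartAt 𝓘(ℝ, E) x₁).symm y) (u ((extChartAt 𝓘(ℝ, E) x₁).symm y))

theorem vectorFieldCoord_extChartAt (u : (x : M) → TangentSpace 𝓘(ℝ, E) x) {x₁ x : M}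
    (hx : x ∈ (chartAt E x₁).source) :
    vectorFieldCoord u x₁ (extChartAt 𝓘(ℝ, E) x₁ x) = chartD 𝓘(ℝ, E) x₁ x (u x) := by
  rw [vectorFieldCoord, (extChartAt 𝓘(ℝ, E) x₁).left_inv (by simpa using hx)]

variable [IsManifold 𝓘(ℝ, E) ∞ M]

theorem differentiableAt_vectorFieldCoord {u : (x : M) → TangentSpace 𝓘(ℝ, E) x}
    (hu : IsSmoothVectorField 𝓘(ℝ, E) u) {x₁ x : M} (hx : x ∈ (chartAt E x₁).source) :
    DifferentiableAt ℝ (vectorFieldCoord u x₁) (extChartAt 𝓘(ℝ, E) x₁ x) :=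
  (contDiffAt_comp_extChartAt_symm hx ((contMDiffAt_vectorField_iff hx).1 (hu x))).differentiableAt
    (by simp)

theorem chartD_mfderiv_section {u : (x : M) → TangentSpace 𝓘(ℝ, E) x}
    (hu : IsSmoothVectorField 𝓘(ℝ, E) u) (x : M) (w : TangentSpace 𝓘(ℝ, E) x) :
    chartD (ITB E) (⟨x, u x⟩ : TB E M) ⟨x, u x⟩
      (mfderiv 𝓘(ℝ, E) (ITB E) (fun y ↦ (⟨y, u y⟩ : TB E M)) x w) =
      (chartD 𝓘(ℝ, E) x x w, fderiv ℝ (vectorFieldCoord u x) (extChartAt 𝓘(ℝ, E) x x)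
        (chartD 𝓘(ℝ, E) x x w)) := by
  have hx := mem_chart_source E x
  have hh : HasFDerivAt (fun y ↦ (y, vectorFieldCoord u x y)) _ (extChartAt 𝓘(ℝ, E) x x) :=
    (hasFDerivAt_id _).prodMk (differentiableAt_vectorFieldCoord hu hx).hasFDerivAt
  refine (mfderiv_comp_eq_fderiv_chart (J := 𝓘(ℝ, E)) (J' := ITB E)
    (f := fun y ↦ (⟨y, u y⟩ : TB E M)) hx (hu.mdifferentiableAt (by simp))
    (mdifferentiableAt_extChartAt (I := ITB E) (mem_chart_source (ModelProd E E) _))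
    hh.differentiableAt ?_ w).trans ?_
  · filter_upwards [(chartAt E x).open_source.mem_nhds hx] with z hz
    rw [extChartAt_TB (p₁ := (⟨x, u x⟩ : TB E M)) (p := ⟨z, u z⟩) hz,
      vectorFieldCoord_extChartAt u hz]
  · rw [hh.fderiv]
    rfl

/-- Comparing base components, the only vector that the section can map to `D` is `u x` itself;
tangency is then equality of fibre components. -/
theorem isIntermediateIntegral_iff (D : SecondOrderEquation E M)
    {u : (x : M) → TangentSpace 𝓘(ℝ, E) x} (hu : IsSmoothVectorField 𝓘(ℝ, E) u) :
    IsIntermediateIntegral D u ↔ ∀ x, fderiv ℝ (vectorFieldCoord u x) (extChartAt 𝓘(ℝ, E) x x)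
      (chartD 𝓘(ℝ, E) x x (u x)) =
        (chartD (ITB E) (⟨x, u x⟩ : TB E M) ⟨x, u x⟩ (D.toFun ⟨x, u x⟩)).2 := by
  refine forall_congr' fun x ↦ ?_
  have hx := mem_chart_source E x
  have hp := mem_chart_source (ModelProd E E) (⟨x, u x⟩ : TB E M)
  have hD : chartD 𝓘(ℝ, E) x x (u x) =
      (chartD (ITB E) (⟨x, u x⟩ : TB E M) ⟨x, u x⟩ (D.toFun ⟨x, u x⟩)).1 := by
    have h := chartD_dProj (p₁ := (⟨x, u x⟩ : TB E M)) (p := ⟨x, u x⟩) hx (D.toFun ⟨x, u x⟩)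
    rw [D.proj_eq] at h
    exact h
  constructor
  · rintro ⟨w, hw⟩
    have h := chartD_mfderiv_section hu x w
    rw [hw] at h
    rw [hD, h]
  · intro h
    refine ⟨u x, ?_⟩
    rw [← chartDInv_chartD hp (D.toFun ⟨x, u x⟩), ← chartDInv_chartD hp
      (mfderiv 𝓘(ℝ, E) (ITB E) (fun y ↦ (⟨y, u y⟩ : TB E M)) x (u x)), chartD_mfderiv_section hu]
    exact congrArg _ (Prod.ext hD h)

namespace PseudoRiemannianMetric

variable {g : PseudoRiemannianMetric E M}

/-- The exterior derivative of the 1-form `i_u T₂` in coordinates. -/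
theorem extDerivOneForm_val_eq {u : (x : M) → TangentSpace 𝓘(ℝ, E) x}
    (hu : IsSmoothVectorField 𝓘(ℝ, E) u) (x : M) (v w : TangentSpace 𝓘(ℝ, E) x)
    {y v' w' : E} (hy : extChartAt 𝓘(ℝ, E) x x = y) (hv : chartD 𝓘(ℝ, E) x x v = v')
    (hw : chartD 𝓘(ℝ, E) x x w = w') :
    extDerivOneForm 𝓘(ℝ, E) (fun y ↦ g.val y (u y)) x v w =
      (fderiv ℝ (g.coord x) y v' (vectorFieldCoord u x y) w' +
        g.coord x y (fderiv ℝ (vectorFieldCoord u x) y v') w') -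
      (fderiv ℝ (g.coord x) y w' (vectorFieldCoord u x y) v' +
        g.coord x y (fderiv ℝ (vectorFieldCoord u x) y w') v') := by
  have hx := mem_chart_source E x
  subst hy hv hw
  obtain ⟨L, hL, hLa⟩ := hasFDerivAt_clm_apply_self (differentiableAt_coord (g := g) hx)
    (differentiableAt_vectorFieldCoord hu hx)
  rw [extDerivOneForm_eq_fderiv hx hL ?_ v w, hLa, hLa]
  · rfl
  · filter_upwards [(chartAt E x).open_source.mem_nhds hx] with z hz a
    rw [vectorFieldCoord_extChartAt u hz, coord_chartD hz]

/-- The differential of the kinetic energy of a vector field in coordinates. -/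
theorem mvfderiv_kinetic_section_eq {u : (x : M) → TangentSpace 𝓘(ℝ, E) x}
    (hu : IsSmoothVectorField 𝓘(ℝ, E) u) (x : M) (w : TangentSpace 𝓘(ℝ, E) x)
    {y w' : E} (hy : extChartAt 𝓘(ℝ, E) x x = y) (hw : chartD 𝓘(ℝ, E) x x w = w') :
    mvfderiv 𝓘(ℝ, E) (fun y ↦ g.kinetic ⟨y, u y⟩) x w =
      (1 / 2) * fderiv ℝ (g.coord x) y w' (vectorFieldCoord u x y) (vectorFieldCoord u x y) +
        g.coord x y (fderiv ℝ (vectorFieldCoord u x) y w') (vectorFieldCoord u x y) := by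
  have hx := mem_chart_source E x
  subst hy hw
  obtain ⟨L, hL, hLa⟩ := hasFDerivAt_half_apply_apply (B := g.coord x)
    (z := (extChartAt 𝓘(ℝ, E) x x, vectorFieldCoord u x (extChartAt 𝓘(ℝ, E) x x)))
    (differentiableAt_coord hx)
  have hU := (differentiableAt_vectorFieldCoord hu hx).hasFDerivAt
  have hh := HasFDerivAt.comp (extChartAt 𝓘(ℝ, E) x x) hL ((hasFDerivAt_id _).prodMk hU)
  rw [mvfderiv_eq_fderiv_chart hx hh.differentiableAt ?_ w, hh.fderiv,
    ContinuousLinearMap.comp_apply, hLa]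
  · simp only [ContinuousLinearMap.prod_apply, ContinuousLinearMap.id_apply]
    rw [coord_symm hx (vectorFieldCoord u x (extChartAt 𝓘(ℝ, E) x x))]
    ring
  · filter_upwards [(chartAt E x).open_source.mem_nhds hx] with z hz
    simp only [Function.comp_apply, id]
    rw [vectorFieldCoord_extChartAt u hz, coord_chartD hz, kinetic]

theorem NewtonEquation.isIntermediateIntegral_iff {D : SecondOrderEquation E M}
    {α : HorizontalForm E M} (h : g.NewtonEquation D α)
    {u : (x : M) → TangentSpace 𝓘(ℝ, E) x} (hu : IsSmoothVectorField 𝓘(ℝ, E) u) :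
    IsIntermediateIntegral D u ↔ g.IntermediateEquation α u := by
  rw [Mechanics.isIntermediateIntegral_iff D hu]
  refine forall_congr' fun x ↦ ?_
  have hx := mem_chart_source E x
  set p : TB E M := ⟨x, u x⟩ with hp
  have hN := (newton_iff (p₁ := p) (p := p) hx (D.proj_eq p) (α.horizontal p)).1 (h p)
  rw [eq_neg_iff_add_eq_zero] at hN
  set y := extChartAt 𝓘(ℝ, E) x x with hy
  have hU : chartD 𝓘(ℝ, E) x x (u x) = vectorFieldCoord u x y :=
    (vectorFieldCoord_extChartAt u hx).symm
  have hΦ : extChartAt (ITB E) p p = (y, vectorFieldCoord u x y) := by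
    rw [extChartAt_TB (p₁ := p) (p := p) hx, ← hU]
  rw [hΦ] at hN
  have key : ∀ w : TangentSpace 𝓘(ℝ, E) x,
      extDerivOneForm 𝓘(ℝ, E) (fun y ↦ g.val y (u y)) x (u x) w
        + mvfderiv 𝓘(ℝ, E) (fun y ↦ g.kinetic ⟨y, u y⟩) x w
        + α.toFun p (mfderiv 𝓘(ℝ, E) (ITB E) (fun y ↦ (⟨y, u y⟩ : TB E M)) x w) =
      g.coord x y (fderiv ℝ (vectorFieldCoord u x) y (vectorFieldCoord u x y) -
        (chartD (ITB E) p p (D.toFun p)).2) (chartD 𝓘(ℝ, E) x x w) := fun w ↦ by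
    have hα : α.toFun p (mfderiv 𝓘(ℝ, E) (ITB E) (fun y ↦ (⟨y, u y⟩ : TB E M)) x w) =
        α.toFun p (chartDInv (ITB E) p p (chartD 𝓘(ℝ, E) x x w, 0)) := by
      rw [horizontal_apply (p₁ := p) hx (α.horizontal p), chartD_mfderiv_section hu]
    have hNw : g.coord x y (chartD (ITB E) p p (D.toFun p)).2 (chartD 𝓘(ℝ, E) x x w) +
        (geodesicTerm (g.coord x) (y, vectorFieldCoord u x y) (chartD 𝓘(ℝ, E) x x w) +
          α.toFun p (chartDInv (ITB E) p p (chartD 𝓘(ℝ, E) x x w, 0))) = 0 :=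
      DFunLike.congr_fun hN (chartD 𝓘(ℝ, E) x x w)
    rw [geodesicTerm_apply] at hNw
    rw [extDerivOneForm_val_eq hu x (u x) w rfl hU rfl,
      mvfderiv_kinetic_section_eq hu x w rfl rfl, hα, map_sub, sub_apply]
    -- The terms `B(DU(w), U)` from the exterior derivative and from the kinetic energy cancel;
    -- `hNw` trades the geodesic term and `α` for the acceleration of `D`.
    linarith
  rw [hU]
  constructor
  · intro hx' w
    refine (key w).trans ?_
    rw [hx', sub_self, map_zero, zero_apply]
  · intro hI
    refine sub_eq_zero.1 (coord_injective (g := g) hx ?_)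
    rw [map_zero]
    ext e
    have h1 := (key (chartDInv 𝓘(ℝ, E) x x e)).symm.trans (hI _)
    rwa [chartD_chartDInv hx] at h1

end PseudoRiemannianMetric

end IntermediateIntegrals

end Mechanics

end

end Development

theorem mainTheorem1 {E M : Type*} [NormedAddCommGroup E] [NormedSpace ℝ E]
    [FiniteDimensional ℝ E] [TopologicalSpace M] [ChartedSpace E M]
    [IsManifold 𝓘(ℝ, E) ∞ M] (g : Mechanics.PseudoRiemannianMetric E M) :
    (∃ e : Mechanics.SecondOrderEquation E M ≃ Mechanics.HorizontalForm E M,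
      ∀ (D : Mechanics.SecondOrderEquation E M) (α : Mechanics.HorizontalForm E M),
        e D = α ↔ g.NewtonEquation D α) ∧
    (∀ (D : Mechanics.SecondOrderEquation E M) (α : Mechanics.HorizontalForm E M),
      g.NewtonEquation D α →
        ∀ u : (x : M) → TangentSpace 𝓘(ℝ, E) x,
          Mechanics.IsSmoothVectorField 𝓘(ℝ, E) u →
            (Mechanics.IsIntermediateIntegral D u ↔ g.IntermediateEquation α u)) :=
  ⟨g.exists_equiv_newtonEquation, fun _ _ h _ hu ↦ h.isIntermediateIntegral_iff hu⟩
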